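/- **Setting.** Let $d\ge 1$ and let $f:\mathbb{R}^d\to[0,\infty)$ be a probability density that vanishes outside a compact set $\mathcal X$ and satisfies $|f(x)-f(x')|\le C_\alpha\|x-x'\|^\alpha$ for all $x,x'\in\mathcal X$, where $0<\alpha\le1$ and $C_\alpha>0$. Let $K(u)=k(\|u\|)$ be a kernel with $k:[0,\infty)\to[0,\infty)$ non-increasing, $\int_{\mathbb{R}^d} K=1$, and $k(t)\le C_\rho e^{-t^\rho}$ for all $t>t_0$, for some $\rho,C_\rho,t_0>0$. Let $h=h(n)>0$ be bandwidths with $h\to0$ and $\frac{\log n}{nh^d}\to0$ as $n\to\infty$. For an i.i.d. sample $X_1,\dots,X_n$ with density $f$ put $$\hat f_h(q)=\frac1{nh^d}\sum_{i=1}^nK\Big(\frac{q-X_i}{h}\Big).$$ Let $\tilde f$ be the (random) output of a KDE oracle with error $\epsilon>0$ and failure probability at most $p$: provided that $h\ge(\log n/n)^{1/d}$, with probability at least $1-p$ one has $(1-\epsilon)\hat f_h(q)\le\tilde f(q)\le(1+\epsilon)\hat f_h(q)$ for all $q\in\mathcal X$ simultaneously. *Quick Shift graph with search radius $\tau$.*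 The vertices are the sample points. For each $i$ the (approximate) neighbour search returns some non-empty set of sample points at distance at most $\tau$ from $X_i$; let $\hat X_i$ be a maximizer of $\tilde f$ over that set; there is an edge $X_i\to\hat X_i$ exactly when $\tilde f(\hat X_i)>\tilde f(X_i)$. (For $(c,h)$-approximate near neighbour search, $\tau=ch$.) *Separation.* With $B(x,r)$ the open ball, $x_1,x_2$ are $(r,\delta)$-separated if there is a set $S\subset\mathbb{R}^d$ that meets every continuous path in $\mathbb{R}^d$ from $x_1$ to $x_2$ and satisfies $$\sup_{x\in S+B(0,r)}f(x)<\inf_{x\in B(x_1,r)\cup B(x_2,r)}f(x)-\delta .$$ **Theorem.** There is a constant $C>0$ and, for every $r_s>0$, a constant $C'>0$ such that for every bandwidth sequence as above and all sufficiently large $n$ the following holds, for every $\epsilon>0$, every $p$, every such sample and oracle, and every search radius $0<\tau<r_s/2$. With probability at least $1-p-\frac1{n^2}$, for every Quick Shift graph $G$ with search radius $\tau$ built from $\tilde f$ and every $\delta>0$ with $$\delta>C\,\epsilon\,\sup_{x\in\mathcal X}\hat f_h(x)\qquad\text{and}\qquad \delta>C'\Big(h^\alpha+\sqrt{\tfrac{\log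 n}{nh^d}}\Big),$$ there is no directed path in $G$ from $X_i$ to $X_j$ whenever $X_i$ and $X_j$ are $(r_s,\delta)$-separated. The constants $C,C'$ depend on neither $n,\epsilon,p,\tau,\delta$ nor the bandwidths, and the threshold for $n$ depends on neither $\epsilon,p,\tau,\delta$ nor the oracle. In particular, for fixed $\delta$ the second condition on $\delta$ holds automatically for all large $n$; and the probability is at least $1-\frac1n$ as soon as the oracle fails with probability at most $\frac1n-\frac1{n^2}$, and at least $1-\frac1n-\frac1{n^2}$ if it fails with probability at most $\frac1n$. -/

import Mathlib

open MeasureTheory ProbabilityTheory Filter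
open scoped Topology Pointwise ENNReal

noncomputable section

/-- `f` is a probability density on `ℝ^d` supported on the compact set `𝒳`. -/
structure IsDensityOn {d : ℕ} (f : EuclideanSpace ℝ (Fin d) → ℝ)
    (𝒳 : Set (EuclideanSpace ℝ (Fin d))) : Prop where
  isCompact : IsCompact 𝒳
  measurable : Measurable f
  nonneg : ∀ x, 0 ≤ f x
  eq_zero : ∀ x, x ∉ 𝒳 → f x = 0
  integral_eq_one : ∫ x, f x = 1

/-- The probability distribution on `ℝ^d` with Lebesgue density `f`. -/
def densityLaw {d : ℕ} (f : EuclideanSpace ℝ (Fin d) → ℝ) :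
    Measure (EuclideanSpace ℝ (Fin d)) :=
  volume.withDensity (fun x => ENNReal.ofReal (f x))

/-- The density `f` is Hölder continuous on `𝒳` with exponent `α` and constant `Cα`. -/
def IsHolderDensity {d : ℕ} (f : EuclideanSpace ℝ (Fin d) → ℝ)
    (𝒳 : Set (EuclideanSpace ℝ (Fin d))) (α Cα : ℝ) : Prop :=
  0 < α ∧ α ≤ 1 ∧ 0 < Cα ∧ ∀ x ∈ 𝒳, ∀ y ∈ 𝒳, |f x - f y| ≤ Cα * ‖x - y‖ ^ α

/-- A radial, non-increasing, nonnegative kernel of total mass one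
with an exponentially decaying tail. -/
def IsRadialKernel {d : ℕ} (K : EuclideanSpace ℝ (Fin d) → ℝ) : Prop :=
  (∃ k : ℝ → ℝ, (∀ t, 0 ≤ t → 0 ≤ k t) ∧ AntitoneOn k (Set.Ici 0) ∧ (∀ u, K u = k ‖u‖) ∧
    ∃ ρ Cρ t₀ : ℝ, 0 < ρ ∧ 0 < Cρ ∧ 0 < t₀ ∧ ∀ t, t₀ < t → k t ≤ Cρ * Real.exp (-t ^ ρ)) ∧
  ∫ u, K u = 1

/-- The kernel density estimator with bandwidth `h` of the data points `x 0, …, x (n - 1)`. -/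
def kde {d n : ℕ} (K : EuclideanSpace ℝ (Fin d) → ℝ) (h : ℝ)
    (x : Fin n → EuclideanSpace ℝ (Fin d)) (q : EuclideanSpace ℝ (Fin d)) : ℝ :=
  1 / (n * h ^ d) * ∑ i, K (h⁻¹ • (q - x i))

/-- The random function `ft` is the output of a KDE oracle with prescribed error `ε` and failure
probability at most `p`: if `h ≥ (log n / n)^(1/d)`, then outside an event of probability at most
`p`, it approximates the kernel density estimator of the sample up to a factor `1 ± ε`
at all points of `𝒳` simultaneously. -/
def IsKDEOracle {d n : ℕ} {Ω : Type*} [MeasurableSpace Ω] (μ : Measure Ω)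
    (𝒳 : Set (EuclideanSpace ℝ (Fin d))) (K : EuclideanSpace ℝ (Fin d) → ℝ) (h ε : ℝ) (p : ℝ≥0∞)
    (X : Fin n → Ω → EuclideanSpace ℝ (Fin d)) (ft : Ω → EuclideanSpace ℝ (Fin d) → ℝ) : Prop :=
  (Real.log n / n) ^ (1 / (d : ℝ)) ≤ h →
    μ {ω | ∀ q ∈ 𝒳, (1 - ε) * kde K h (fun i => X i ω) q ≤ ft ω q ∧
      ft ω q ≤ (1 + ε) * kde K h (fun i => X i ω) q}ᶜ ≤ p

/-- `G` is a directed graph that Quick Shift can return on the data points `x` when it uses the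
density values `ft` and the search radius `τ`. The vertices are the (indices of the) data points;
the neighbour search for `x i` returns a non-empty set `N i` of data points at distance at most `τ`
from `x i`; `xhat i` maximizes `ft` over `N i`; and there is an edge from `i` to `xhat i` if and
only if `ft` is strictly larger at `xhat i` than at `i`. For `(c, h)`-approximate near neighbour
search, the radius is `τ = c * h`; exact search is the case where `N i` is the whole ball. -/
def IsQuickShiftGraph {d n : ℕ} (x : Fin n → EuclideanSpace ℝ (Fin d))
    (ft : EuclideanSpace ℝ (Fin d) → ℝ) (τ : ℝ) (G : Digraph (Fin n)) : Prop :=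
  ∃ (N : Fin n → Finset (Fin n)) (xhat : Fin n → Fin n),
    (∀ i, ∀ j ∈ N i, ‖x j - x i‖ ≤ τ) ∧
    (∀ i, xhat i ∈ N i ∧ ∀ j ∈ N i, ft (x j) ≤ ft (x (xhat i))) ∧
    ∀ i j, G.Adj i j ↔ j = xhat i ∧ ft (x i) < ft (x j)

/-- The points `x₁` and `x₂` are `(r, δ)`-separated with respect to the density `f` on `ℝ^d`. -/
def IsSeparated {d : ℕ} (f : EuclideanSpace ℝ (Fin d) → ℝ) (r δ : ℝ)
    (x₁ x₂ : EuclideanSpace ℝ (Fin d)) : Prop :=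
  ∃ S : Set (EuclideanSpace ℝ (Fin d)),
    (∀ γ : Path x₁ x₂, ∃ t, γ t ∈ S) ∧
    sSup (f '' (S + Metric.ball 0 r)) <
      sInf (f '' (Metric.ball x₁ r ∪ Metric.ball x₂ r)) - δ

end

/-! A directed path in the graph traces a polygonal path, which must meet the separating set `S` at
some point `s`. The values of `ft` increase along edges, so the tail `x l` of the edge containing
`s` satisfies `ft (x i) ≤ ft (x l)` and lies within `τ < r / 2` of `s`. Hence `f` is at most the
supremum `M` near `S` on the ball of radius `r / 2` about `x l`, and at least the infimum `m` near
the endpoints on the same ball about `x i`. If the estimator nearly respects these local bounds, its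
values at `x l` and `x i` differ by almost `m - M > δ`, which the oracle error cannot hide
(`not_reflTransGen_of_isSeparated`).

Only values at sample points matter, so no uniform bound over all `q` is needed. Conditionally on `X
i`, the other summands of the estimator are i.i.d., and a Chernoff bound with a union bound over `i`
gives deviation of order `√(log n / (n h ^ d))` from the mean (`measure_kde_deviation_le`).

For the mean, `smoothedDensity`, the part of the kernel leaving the ball is bounded by its `α`-th
moment, which costs `O(h ^ α)` (`smoothedDensity_le_of_ball`, `le_smoothedDensity_of_ball`). The
Hölder condition serves to bound `f` globally; `f` may jump at the boundary of `𝒳`. -/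

/-! ### Chernoff bounds with variance control. -/

/-- The moment generating function of a centred bounded random variable is controlled
by its second moment. -/
lemma integral_exp_mul_le_exp_sq {E : Type*} [MeasurableSpace E] {P : Measure E}
    [IsProbabilityMeasure P] {Y : E → ℝ} (hY : Measurable Y) {b v l : ℝ}
    (hb : ∀ x, |Y x| ≤ b) (hmean : ∫ x, Y x ∂P = 0) (hvar : ∫ x, Y x ^ 2 ∂P ≤ v)
    (hl : 0 ≤ l) (hlb : l * b ≤ 1) :
    ∫ x, Real.exp (l * Y x) ∂P ≤ Real.exp (l ^ 2 * v) := by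
  have hYint : Integrable Y P :=
    Integrable.of_bound hY.aestronglyMeasurable b (ae_of_all _ fun x => hb x)
  have hY2int : Integrable (fun x => Y x ^ 2) P :=
    Integrable.of_bound (hY.pow_const 2).aestronglyMeasurable (b ^ 2)
      (ae_of_all _ fun x => by
        rw [Real.norm_eq_abs, abs_pow]; exact pow_le_pow_left₀ (abs_nonneg _) (hb x) 2)
  have hbd : ∀ x, |l * Y x| ≤ 1 := fun x => by
    rw [abs_mul, abs_of_nonneg hl]
    exact (mul_le_mul_of_nonneg_left (hb x) hl).trans hlb
  have hexp : Integrable (fun x => Real.exp (l * Y x)) P :=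
    Integrable.of_bound (hY.const_mul l).exp.aestronglyMeasurable (Real.exp 1)
      (ae_of_all _ fun x => by
        rw [Real.norm_eq_abs, Real.abs_exp]
        exact Real.exp_le_exp.2 ((le_abs_self _).trans (hbd x)))
  calc ∫ x, Real.exp (l * Y x) ∂P
      ≤ ∫ x, (1 + l * Y x + l ^ 2 * Y x ^ 2) ∂P := by
        refine integral_mono hexp
          (((integrable_const _).add (hYint.const_mul l)).add (hY2int.const_mul _)) fun x => ?_
        -- This is `exp y ≤ 1 + y + y ^ 2` for `|y| ≤ 1`; the linear term then integrates to zero.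
        have := (abs_le.1 (Real.abs_exp_sub_one_sub_id_le (hbd x))).2
        rw [mul_pow] at this
        dsimp only
        linarith
    _ = 1 + l ^ 2 * ∫ x, Y x ^ 2 ∂P := by
        rw [integral_add (f := fun x => 1 + l * Y x)
          ((integrable_const _).add (hYint.const_mul l)) (hY2int.const_mul _),
          integral_add (integrable_const _) (hYint.const_mul l), integral_const_mul,
          integral_const_mul, hmean]
        simp
    _ ≤ 1 + l ^ 2 * v := by gcongr
    _ ≤ Real.exp (l ^ 2 * v) := by linarith [Real.add_one_le_exp (l ^ 2 * v)]

section Concentration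

variable {Ω : Type*} [MeasurableSpace Ω] {μ : Measure Ω} [IsProbabilityMeasure μ]
  {E : Type*} [MeasurableSpace E] {P : Measure E} {ι : Type*} {X : ι → Ω → E}

/-- Upper tail bound for a sum of centred bounded functions of i.i.d. random variables. -/
lemma measure_sum_ge_le {Y : E → ℝ} (hX : ∀ i, HasLaw (X i) P μ) (hind : iIndepFun X μ)
    (hY : Measurable Y) {b v l : ℝ} (hb : ∀ x, |Y x| ≤ b) (hmean : ∫ x, Y x ∂P = 0)
    (hvar : ∫ x, Y x ^ 2 ∂P ≤ v) (hl : 0 ≤ l) (hlb : l * b ≤ 1) (T : Finset ι) (t : ℝ) :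
    μ.real {ω | t ≤ ∑ j ∈ T, Y (X j ω)} ≤ Real.exp (-l * t + T.card * (l ^ 2 * v)) := by
  have hXm : ∀ j, AEMeasurable (fun ω => Y (X j ω)) μ := fun j =>
    hY.comp_aemeasurable (hX j).aemeasurable
  have hfac : ∀ j ∈ T, mgf (fun ω => Y (X j ω)) μ l ≤ Real.exp (l ^ 2 * v) := fun j _ => by
    have : IsProbabilityMeasure P := (hX j).isProbabilityMeasure_iff.1 inferInstance
    have := (hX j).integral_comp (f := fun x => Real.exp (l * Y x))
      (by fun_prop)
    rw [mgf]
    refine (le_of_eq this).trans (integral_exp_mul_le_exp_sq hY hb hmean hvar hl hlb)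
  have hint : Integrable (fun ω => Real.exp (l * ∑ j ∈ T, Y (X j ω))) μ := by
    refine Integrable.of_bound
      ((Finset.aemeasurable_fun_sum T fun j _ => hXm j).const_mul l).exp.aestronglyMeasurable
      (Real.exp (l * (T.card * b))) (ae_of_all _ fun ω => ?_)
    rw [Real.norm_eq_abs, Real.abs_exp, Real.exp_le_exp]
    refine mul_le_mul_of_nonneg_left ?_ hl
    rw [← nsmul_eq_mul]
    exact Finset.sum_le_card_nsmul _ _ _ fun j _ => (le_abs_self _).trans (hb _)
  have hind' : iIndepFun (fun j ω => Y (X j ω)) μ := hind.comp (fun _ => Y) fun _ => hY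
  have hsum := hind'.mgf_sum₀ (t := l) hXm T
  have hfun : (∑ j ∈ T, fun ω => Y (X j ω)) = fun ω => ∑ j ∈ T, Y (X j ω) := by
    ext ω; simp
  rw [hfun] at hsum
  refine (measure_ge_le_exp_mul_mgf t hl hint).trans ?_
  rw [hsum, Real.exp_add]
  refine mul_le_mul_of_nonneg_left ?_ (Real.exp_pos _).le
  calc ∏ j ∈ T, mgf (fun ω => Y (X j ω)) μ l
      ≤ ∏ _j ∈ T, Real.exp (l ^ 2 * v) :=
        Finset.prod_le_prod (fun j _ => mgf_nonneg) hfac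
    _ = Real.exp (T.card * (l ^ 2 * v)) := by
        rw [Finset.prod_const, ← Real.exp_nat_mul]

/-- Two-sided tail bound for a sum of centred bounded functions of i.i.d. random variables. -/
lemma measure_abs_sum_ge_le {Y : E → ℝ} (hX : ∀ i, HasLaw (X i) P μ) (hind : iIndepFun X μ)
    (hY : Measurable Y) {b v l : ℝ} (hb : ∀ x, |Y x| ≤ b) (hmean : ∫ x, Y x ∂P = 0)
    (hvar : ∫ x, Y x ^ 2 ∂P ≤ v) (hl : 0 ≤ l) (hlb : l * b ≤ 1) (T : Finset ι) (t : ℝ) :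
    μ {ω | t ≤ |∑ j ∈ T, Y (X j ω)|} ≤
      ENNReal.ofReal (2 * Real.exp (-l * t + T.card * (l ^ 2 * v))) := by
  have h1 := measure_sum_ge_le hX hind hY hb hmean hvar hl hlb T t
  have h2 := measure_sum_ge_le (Y := fun x => -Y x) hX hind hY.neg
    (b := b) (v := v) (l := l) (by simpa using hb)
    (by rw [integral_neg, hmean, neg_zero]) (by simpa using hvar) hl hlb T t
  rw [← ENNReal.ofReal_toReal (measure_ne_top μ {ω | t ≤ |∑ j ∈ T, Y (X j ω)|})]
  refine ENNReal.ofReal_le_ofReal ?_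
  change μ.real _ ≤ _
  have hsub : {ω | t ≤ |∑ j ∈ T, Y (X j ω)|} ⊆
      {ω | t ≤ ∑ j ∈ T, Y (X j ω)} ∪ {ω | t ≤ ∑ j ∈ T, -Y (X j ω)} := fun ω hω => by
    rcases le_abs.1 (show t ≤ |∑ j ∈ T, Y (X j ω)| from hω) with h | h
    · exact Or.inl h
    · right
      show t ≤ ∑ j ∈ T, -Y (X j ω)
      rwa [Finset.sum_neg_distrib]
  calc _ ≤ _ := measureReal_mono hsub
    _ ≤ _ := measureReal_union_le _ _
    _ ≤ _ := by linarith

/-- Tail bound for a sum of centred bounded functions of i.i.d. random variables, where the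
functions depend on another independent random variable of the family. -/
lemma measure_abs_sum_erase_ge_le [Fintype ι] [DecidableEq ι] {Y : E → E → ℝ}
    (hX : ∀ i, HasLaw (X i) P μ)
    (hind : iIndepFun X μ) (hY : Measurable (Function.uncurry Y)) {b v l : ℝ}
    (hb : ∀ q x, |Y q x| ≤ b) (hmean : ∀ q, ∫ x, Y q x ∂P = 0)
    (hvar : ∀ q, ∫ x, Y q x ^ 2 ∂P ≤ v) (hl : 0 ≤ l) (hlb : l * b ≤ 1) (i : ι)
    (t : ℝ) :
    μ {ω | t ≤ |∑ j ∈ Finset.univ.erase i, Y (X i ω) (X j ω)|} ≤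
      ENNReal.ofReal (2 * Real.exp (-l * t + Fintype.card ι * (l ^ 2 * v))) := by
  set T : Finset ι := Finset.univ.erase i with hT
  have : IsProbabilityMeasure P := (hX i).isProbabilityMeasure_iff.1 inferInstance
  have hXm : ∀ j, AEMeasurable (X j) μ := fun j => (hX j).aemeasurable
  let Z : Ω → (T → E) := fun ω j => X j ω
  have hZ : AEMeasurable Z μ := aemeasurable_pi_lambda _ fun j => hXm j
  -- Independence makes the joint law a product, so Fubini lets `X i` be frozen at a value `q` and
  -- the fixed-function bound applied for each `q`.
  have hpair : IndepFun (X i) Z μ := by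
    have h := hind.indepFun_finset₀ {i} T (by simp [hT]) hXm
    exact h.comp (φ := fun z : (({i} : Finset ι) → E) => z ⟨i, by simp⟩)
      (ψ := id) (measurable_pi_apply _) measurable_id
  have hmap := hpair.map_prod_eq_prod_map_map (hXm i) hZ
  let B : Set (E × (T → E)) := {z | t ≤ |∑ j : T, Y z.1 (z.2 j)|}
  have hB : MeasurableSet B := by
    refine measurableSet_le measurable_const ?_
    refine (Finset.measurable_sum _ fun j _ => ?_).abs
    exact hY.comp (measurable_fst.prodMk ((measurable_pi_apply j).comp measurable_snd))
  have hpre : {ω | t ≤ |∑ j ∈ T, Y (X i ω) (X j ω)|} = (fun ω => (X i ω, Z ω)) ⁻¹' B := by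
    ext ω
    simp only [Set.mem_ofPred_eq, Set.mem_preimage, B, Z]
    rw [← Finset.sum_coe_sort T fun j => Y (X i ω) (X j ω)]
  rw [hpre, ← Measure.map_apply_of_aemeasurable ((hXm i).prodMk hZ) hB, hmap,
    Measure.prod_apply hB, (hX i).map_eq]
  have : IsProbabilityMeasure (μ.map Z) := Measure.isProbabilityMeasure_map hZ
  calc ∫⁻ q, (μ.map Z) (Prod.mk q ⁻¹' B) ∂P
      ≤ ∫⁻ _q, ENNReal.ofReal (2 * Real.exp (-l * t + Fintype.card ι * (l ^ 2 * v))) ∂P := by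
        refine lintegral_mono fun q => ?_
        rw [Measure.map_apply_of_aemeasurable hZ (measurable_prodMk_left hB)]
        have hq : Z ⁻¹' (Prod.mk q ⁻¹' B) = {ω | t ≤ |∑ j ∈ T, Y q (X j ω)|} := by
          ext ω
          simp only [Set.mem_ofPred_eq, Set.mem_preimage, B, Z]
          rw [← Finset.sum_coe_sort T fun j => Y q (X j ω)]
        rw [hq]
        refine (measure_abs_sum_ge_le hX hind (hY.comp measurable_prodMk_left) (hb q) (hmean q)
          (hvar q) hl hlb T t).trans ?_
        have hv : 0 ≤ v := (integral_nonneg fun _ => sq_nonneg _).trans (hvar q)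
        gcongr
        exact T.card_le_univ
    _ = _ := by simp

end Concentration

/-! ### Densities and kernels: boundedness, tails, moments. -/

variable {d : ℕ}

lemma IsDensityOn.exists_bound {f : EuclideanSpace ℝ (Fin d) → ℝ}
    {𝒳 : Set (EuclideanSpace ℝ (Fin d))} (hf : IsDensityOn f 𝒳) {α Cα : ℝ}
    (hα : IsHolderDensity f 𝒳 α Cα) : ∃ F : ℝ, 0 < F ∧ ∀ x, f x ≤ F := by
  obtain ⟨hα0, -, hC, hH⟩ := hα
  obtain rfl | ⟨x₀, hx₀⟩ := 𝒳.eq_empty_or_nonempty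
  · exact ⟨1, one_pos, fun x => by rw [hf.eq_zero x (by simp)]; exact zero_le_one⟩
  have hF : 0 ≤ f x₀ + Cα * Metric.diam 𝒳 ^ α :=
    add_nonneg (hf.nonneg _) (mul_nonneg hC.le (Real.rpow_nonneg Metric.diam_nonneg _))
  refine ⟨f x₀ + Cα * Metric.diam 𝒳 ^ α + 1, by linarith, fun x => ?_⟩
  by_cases hx : x ∈ 𝒳
  · have h1 := (abs_le.1 (hH x hx x₀ hx₀)).2
    have h2 : Cα * ‖x - x₀‖ ^ α ≤ Cα * Metric.diam 𝒳 ^ α := by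
      rw [← dist_eq_norm]
      gcongr
      exact Metric.dist_le_diam_of_mem hf.isCompact.isBounded hx hx₀
    linarith
  · rw [hf.eq_zero x hx]; linarith

lemma IsDensityOn.integrable {f : EuclideanSpace ℝ (Fin d) → ℝ}
    {𝒳 : Set (EuclideanSpace ℝ (Fin d))} (hf : IsDensityOn f 𝒳) : Integrable f := by
  by_contra h
  have := hf.integral_eq_one
  rw [integral_undef h] at this
  exact zero_ne_one this

lemma integral_densityLaw {f : EuclideanSpace ℝ (Fin d) → ℝ}
    {𝒳 : Set (EuclideanSpace ℝ (Fin d))} (hf : IsDensityOn f 𝒳)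
    (g : EuclideanSpace ℝ (Fin d) → ℝ) :
    ∫ x, g x ∂(densityLaw f) = ∫ x, g x * f x := by
  rw [densityLaw, integral_withDensity_eq_integral_toReal_smul hf.measurable.ennreal_ofReal
    (ae_of_all _ fun _ => ENNReal.ofReal_lt_top)]
  refine integral_congr_ae (ae_of_all _ fun x => ?_)
  simp only [ENNReal.toReal_ofReal (hf.nonneg x), smul_eq_mul]
  ring

lemma densityLaw_compl_eq_zero {f : EuclideanSpace ℝ (Fin d) → ℝ}
    {𝒳 : Set (EuclideanSpace ℝ (Fin d))} (hf : IsDensityOn f 𝒳) : densityLaw f 𝒳ᶜ = 0 := by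
  have hm : MeasurableSet 𝒳ᶜ := hf.isCompact.measurableSet.compl
  rw [densityLaw, withDensity_apply _ hm, setLIntegral_congr_fun hm (g := fun _ => 0)]
  · simp
  · intro x hx
    simp [hf.eq_zero x hx]

namespace IsRadialKernel

variable {K : EuclideanSpace ℝ (Fin d) → ℝ}

lemma nonneg (hK : IsRadialKernel K) (u : EuclideanSpace ℝ (Fin d)) : 0 ≤ K u := by
  obtain ⟨⟨k, hk0, -, hKk, -⟩, -⟩ := hK
  rw [hKk]; exact hk0 _ (norm_nonneg _)

lemma le_apply_zero (hK : IsRadialKernel K) (u : EuclideanSpace ℝ (Fin d)) : K u ≤ K 0 := by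
  obtain ⟨⟨k, -, hk, hKk, -⟩, -⟩ := hK
  rw [hKk, hKk, norm_zero]
  exact hk (Set.mem_Ici.2 le_rfl) (Set.mem_Ici.2 (norm_nonneg _)) (norm_nonneg _)

lemma measurable (hK : IsRadialKernel K) : Measurable K := by
  obtain ⟨⟨k, -, hk, hKk, -⟩, -⟩ := hK
  -- `k` is monotone only on `[0, ∞)`; precomposing with `max · 0` gives a globally antitone, hence
  -- measurable, function.
  have h1 : Antitone fun t => k (max t 0) := fun s t hst =>
    hk (Set.mem_Ici.2 (le_max_right _ _)) (Set.mem_Ici.2 (le_max_right _ _))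
      (max_le_max hst le_rfl)
  have h2 : K = fun u => (fun t => k (max t 0)) ‖u‖ := by
    ext u; simp [hKk]
  rw [h2]
  exact h1.measurable.comp measurable_norm

lemma integrable (hK : IsRadialKernel K) : Integrable K := by
  by_contra h
  have := hK.2
  rw [integral_undef h] at this
  exact zero_ne_one this

/-- A radial kernel with exponential tail decays faster than every power. -/
lemma exists_le_rpow (hK : IsRadialKernel K) {s : ℝ} (hs : 0 ≤ s) :
    ∃ B : ℝ, ∀ u, K u ≤ B * (1 + ‖u‖) ^ (-s) := by
  have hK0 := hK.nonneg 0
  have hle := hK.le_apply_zero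
  obtain ⟨⟨k, hk0, hk, hKk, ρ, Cρ, t₀, hρ, hC, ht₀, htail⟩, -⟩ := hK
  -- `t ^ s` is written as a power of `t ^ ρ` to reduce to the ordinary exponential.
  have hlim : Tendsto (fun t : ℝ => (t ^ ρ) ^ (s / ρ) * Real.exp (-1 * t ^ ρ)) atTop (𝓝 0) :=
    (tendsto_rpow_mul_exp_neg_mul_atTop_nhds_zero (s / ρ) 1 one_pos).comp
      (tendsto_rpow_atTop hρ)
  obtain ⟨t₁, ht₁⟩ := eventually_atTop.1 (hlim.eventually (gt_mem_nhds one_pos))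
  -- The 1 ensures `1 + ‖u‖ ≤ 2 * ‖u‖` beyond `t₂`, the source of the factor `2 ^ s`.
  set t₂ := max (max t₀ t₁) 1 with ht₂
  refine ⟨K 0 * (1 + t₂) ^ s + Cρ * 2 ^ s, fun u => ?_⟩
  have hu : 0 < 1 + ‖u‖ := by positivity
  have ht₂1 : 1 ≤ t₂ := le_max_right _ _
  have hA : 0 ≤ K 0 * (1 + t₂) ^ s := by positivity
  have hB : 0 ≤ Cρ * (2 : ℝ) ^ s := by positivity
  rw [Real.rpow_neg hu.le, ← div_eq_mul_inv, le_div_iff₀ (Real.rpow_pos_of_pos hu _)]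
  rcases le_or_gt ‖u‖ t₂ with h | h
  · have : K u * (1 + ‖u‖) ^ s ≤ K 0 * (1 + t₂) ^ s := by
      gcongr
      exact hle u
    linarith
  · have h0 : t₀ < ‖u‖ := ((le_max_left _ _).trans (le_max_left _ _)).trans_lt h
    have h1 : t₁ ≤ ‖u‖ := ((le_max_right _ _).trans (le_max_left _ _)).trans h.le
    have h2 : 1 ≤ ‖u‖ := ht₂1.trans h.le
    have h3 := ht₁ _ h1
    rw [← Real.rpow_mul (norm_nonneg u), mul_div_cancel₀ _ hρ.ne', neg_one_mul] at h3
    have h4 : K u * (1 + ‖u‖) ^ s ≤ Cρ * 2 ^ s := by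
      calc K u * (1 + ‖u‖) ^ s
          ≤ (Cρ * Real.exp (-‖u‖ ^ ρ)) * (2 * ‖u‖) ^ s := by
            refine mul_le_mul ((hKk u).trans_le (htail _ h0))
              (Real.rpow_le_rpow hu.le (by linarith) hs) (by positivity) (by positivity)
        _ = Cρ * 2 ^ s * (‖u‖ ^ s * Real.exp (-‖u‖ ^ ρ)) := by
            rw [Real.mul_rpow two_pos.le (norm_nonneg u)]; ring
        _ ≤ Cρ * 2 ^ s * 1 := by gcongr
        _ = _ := mul_one _
    linarith

lemma integrable_mul_norm_rpow (hK : IsRadialKernel K) {α : ℝ} (hα : 0 ≤ α) :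
    Integrable fun u => K u * ‖u‖ ^ α := by
  -- After `‖u‖ ^ α` is absorbed, decay of order `d + 1` remains, which is integrable in dimension
  -- `d`.
  obtain ⟨B, hB⟩ := hK.exists_le_rpow (s := (d + 1 : ℝ) + α) (by positivity)
  have hint : Integrable (fun u : EuclideanSpace ℝ (Fin d) => (1 + ‖u‖) ^ (-(d + 1 : ℝ))) :=
    integrable_one_add_norm (by simp)
  refine (hint.const_mul B).mono'
    (hK.measurable.mul (measurable_norm.pow_const α)).aestronglyMeasurable
    (ae_of_all _ fun u => ?_)
  have hu : 0 < 1 + ‖u‖ := by positivity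
  rw [Real.norm_eq_abs, abs_of_nonneg (mul_nonneg (hK.nonneg u) (by positivity))]
  calc K u * ‖u‖ ^ α ≤ (B * (1 + ‖u‖) ^ (-((d + 1 : ℝ) + α))) * (1 + ‖u‖) ^ α := by
        refine mul_le_mul (hB u) (Real.rpow_le_rpow (norm_nonneg u) (by linarith) hα)
          (by positivity) ((hK.nonneg u).trans (hB u))
    _ = B * (1 + ‖u‖) ^ (-(d + 1 : ℝ)) := by
        rw [mul_assoc, ← Real.rpow_add hu]; congr 2; ring

end IsRadialKernel

/-! ### Mean of the estimator and its bias. -/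

/-- The convolution of `f` with the rescaled kernel `h⁻ᵈ K(·/h)`, i.e. the mean of the kernel
density estimator. -/
noncomputable def smoothedDensity (K f : EuclideanSpace ℝ (Fin d) → ℝ) (h : ℝ)
    (q : EuclideanSpace ℝ (Fin d)) : ℝ :=
  ∫ u, K u * f (q - h • u)

section Bias

variable {K f : EuclideanSpace ℝ (Fin d) → ℝ} {𝒳 : Set (EuclideanSpace ℝ (Fin d))} {h : ℝ}

lemma integral_kernel_densityLaw (hf : IsDensityOn f 𝒳) (hh : 0 < h)
    (q : EuclideanSpace ℝ (Fin d)) :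
    ∫ x, K (h⁻¹ • (q - x)) ∂(densityLaw f) = h ^ d * smoothedDensity K f h q := by
  rw [integral_densityLaw hf,
    ← integral_sub_left_eq_self (fun x => K (h⁻¹ • (q - x)) * f x) volume q]
  have h1 := Measure.integral_comp_inv_smul_of_nonneg volume
    (fun u => K u * f (q - h • u)) hh.le
  simp only [finrank_euclideanSpace, Fintype.card_fin, smul_eq_mul] at h1
  rw [smoothedDensity, ← h1]
  refine integral_congr_ae (ae_of_all _ fun x => ?_)
  simp [smul_smul, hh.ne']

lemma integrable_mul_comp (hK : IsRadialKernel K) (hf : IsDensityOn f 𝒳) {F : ℝ}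
    (hF : ∀ x, f x ≤ F) (q : EuclideanSpace ℝ (Fin d)) :
    Integrable fun u => K u * f (q - h • u) := by
  have hm : Measurable fun u : EuclideanSpace ℝ (Fin d) => f (q - h • u) :=
    hf.measurable.comp (by fun_prop)
  refine (hK.integrable.const_mul F).mono' (hK.measurable.mul hm).aestronglyMeasurable
    (ae_of_all _ fun u => ?_)
  rw [Real.norm_eq_abs, abs_of_nonneg (mul_nonneg (hK.nonneg u) (hf.nonneg _)), mul_comm]
  exact mul_le_mul_of_nonneg_right (hF _) (hK.nonneg u)

lemma smoothedDensity_le (hK : IsRadialKernel K) (hf : IsDensityOn f 𝒳) {F : ℝ}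
    (hF : ∀ x, f x ≤ F) (q : EuclideanSpace ℝ (Fin d)) : smoothedDensity K f h q ≤ F := by
  calc smoothedDensity K f h q ≤ ∫ u, K u * F :=
        integral_mono (integrable_mul_comp hK hf hF q) (hK.integrable.mul_const F) fun u =>
          mul_le_mul_of_nonneg_left (hF _) (hK.nonneg u)
    _ = F := by rw [integral_mul_const, hK.2, one_mul]

/-- A Markov-type inequality: leaving the ball means `h * ‖u‖ ≥ r`. It bounds the kernel mass
outside the ball by an `α`-th moment times `(h / r) ^ α`. -/
lemma one_le_scaled_norm_rpow {α r : ℝ} (hα : 0 ≤ α) (hh : 0 < h) (hr : 0 < r)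
    {q u : EuclideanSpace ℝ (Fin d)} (hu : q - h • u ∉ Metric.ball q r) :
    1 ≤ (h / r) ^ α * ‖u‖ ^ α := by
  rw [← Real.mul_rpow (by positivity) (norm_nonneg u)]
  refine Real.one_le_rpow ?_ hα
  rw [Metric.mem_ball, not_lt, dist_eq_norm, sub_sub_cancel_left, norm_neg, norm_smul,
    Real.norm_eq_abs, abs_of_pos hh] at hu
  rw [div_mul_eq_mul_div, le_div_iff₀ hr]
  linarith

/-- The smoothed density exceeds a local upper bound of `f` by at most the kernel tail. -/
lemma smoothedDensity_le_of_ball (hK : IsRadialKernel K) (hf : IsDensityOn f 𝒳) {F α r M : ℝ}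
    (hF0 : 0 ≤ F) (hF : ∀ x, f x ≤ F) (hα : 0 ≤ α) (hh : 0 < h) (hr : 0 < r)
    {q : EuclideanSpace ℝ (Fin d)} (hM0 : 0 ≤ M) (hM : ∀ y ∈ Metric.ball q r, f y ≤ M) :
    smoothedDensity K f h q ≤ M + F * ((h / r) ^ α * ∫ u, K u * ‖u‖ ^ α) := by
  have hmom := hK.integrable_mul_norm_rpow hα
  calc smoothedDensity K f h q
      ≤ ∫ u, (K u * M + F * ((h / r) ^ α * (K u * ‖u‖ ^ α))) := by
        refine integral_mono (integrable_mul_comp hK hf hF q)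
          ((hK.integrable.mul_const M).add ((hmom.const_mul _).const_mul _)) fun u => ?_
        have hKu := hK.nonneg u
        have key : f (q - h • u) ≤ M + F * ((h / r) ^ α * ‖u‖ ^ α) := by
          by_cases hu : q - h • u ∈ Metric.ball q r
          · have : 0 ≤ F * ((h / r) ^ α * ‖u‖ ^ α) := by positivity
            linarith [hM _ hu]
          · have := mul_le_mul_of_nonneg_left (one_le_scaled_norm_rpow hα hh hr hu) hF0
            linarith [hF (q - h • u)]
        have := mul_le_mul_of_nonneg_left key hKu
        dsimp only
        linarith
    _ = M + F * ((h / r) ^ α * ∫ u, K u * ‖u‖ ^ α) := by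
        rw [integral_add (hK.integrable.mul_const M) ((hmom.const_mul _).const_mul _),
          integral_mul_const, hK.2, one_mul, integral_const_mul, integral_const_mul]

/-- The smoothed density falls below a local lower bound of `f` by at most the kernel tail. -/
lemma le_smoothedDensity_of_ball (hK : IsRadialKernel K) (hf : IsDensityOn f 𝒳) {F α r m : ℝ}
    (hF0 : 0 ≤ F) (hF : ∀ x, f x ≤ F) (hα : 0 ≤ α) (hh : 0 < h) (hr : 0 < r)
    {q : EuclideanSpace ℝ (Fin d)} (hm : ∀ y ∈ Metric.ball q r, m ≤ f y) :
    m ≤ smoothedDensity K f h q + F * ((h / r) ^ α * ∫ u, K u * ‖u‖ ^ α) := by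
  have hmom := hK.integrable_mul_norm_rpow hα
  have hint := integrable_mul_comp (h := h) hK hf hF q
  have hmF : m ≤ F := (hm q (Metric.mem_ball_self hr)).trans (hF q)
  calc m = ∫ u, K u * m := by rw [integral_mul_const, hK.2, one_mul]
    _ ≤ ∫ u, (K u * f (q - h • u) + F * ((h / r) ^ α * (K u * ‖u‖ ^ α))) := by
        refine integral_mono (hK.integrable.mul_const m)
          (hint.add ((hmom.const_mul _).const_mul _)) fun u => ?_
        have hKu := hK.nonneg u
        have key : m ≤ f (q - h • u) + F * ((h / r) ^ α * ‖u‖ ^ α) := by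
          by_cases hu : q - h • u ∈ Metric.ball q r
          · have : 0 ≤ F * ((h / r) ^ α * ‖u‖ ^ α) := by positivity
            linarith [hm _ hu]
          · have := mul_le_mul_of_nonneg_left (one_le_scaled_norm_rpow hα hh hr hu) hF0
            linarith [hf.nonneg (q - h • u)]
        have := mul_le_mul_of_nonneg_left key hKu
        dsimp only
        linarith
    _ = smoothedDensity K f h q + F * ((h / r) ^ α * ∫ u, K u * ‖u‖ ^ α) := by
        rw [integral_add hint ((hmom.const_mul _).const_mul _),
          integral_const_mul, integral_const_mul, smoothedDensity]

end Bias

/-! ### Deviation of the estimator at the sample points. -/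

section KDEConcentration

variable {d n : ℕ} {K f : EuclideanSpace ℝ (Fin d) → ℝ} {𝒳 : Set (EuclideanSpace ℝ (Fin d))}

lemma isProbabilityMeasure_densityLaw (hf : IsDensityOn f 𝒳) :
    IsProbabilityMeasure (densityLaw f) := by
  refine ⟨?_⟩
  rw [densityLaw, withDensity_apply _ MeasurableSet.univ, Measure.restrict_univ,
    ← ofReal_integral_eq_lintegral_ofReal hf.integrable (ae_of_all _ hf.nonneg),
    hf.integral_eq_one, ENNReal.ofReal_one]

/-- At the sample points, the kernel density estimator is uniformly close to its mean. -/
lemma measure_kde_deviation_le {Ω : Type*} [MeasurableSpace Ω] {μ : Measure Ω}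
    [IsProbabilityMeasure μ] {X : Fin n → Ω → EuclideanSpace ℝ (Fin d)}
    (hf : IsDensityOn f 𝒳) (hK : IsRadialKernel K) {F h w : ℝ}
    (hF : ∀ x, f x ≤ F) (hX : ∀ i, HasLaw (X i) (densityLaw f) μ) (hind : iIndepFun X μ)
    (hn : 3 ≤ n) (hh : 0 < h) (hw : w = √(Real.log n / (n * h ^ d))) (hw1 : w ≤ 1)
    (hwK : w * K 0 ≤ 1) :
    μ {ω | ∀ i, |kde K h (fun j => X j ω) (X i ω) - smoothedDensity K f h (X i ω)| ≤
      (K 0 * F + 4 + K 0) * w}ᶜ ≤ 1 / (n : ℝ≥0∞) ^ 2 := by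
  have := isProbabilityMeasure_densityLaw hf
  set b := K 0 with hb
  have hb0 : 0 ≤ b := hK.nonneg 0
  have hn3 : (3 : ℝ) ≤ n := by exact_mod_cast hn
  have hn0 : (0 : ℝ) < n := by linarith
  have hlog : 1 ≤ Real.log n := by
    rw [Real.le_log_iff_exp_le hn0]
    linarith [Real.exp_one_lt_d9]
  have hN : 0 < (n : ℝ) * h ^ d := by positivity
  have hw0 : 0 ≤ w := hw ▸ Real.sqrt_nonneg _
  have hNw : (n : ℝ) * h ^ d * w ^ 2 = Real.log n := by
    rw [hw, Real.sq_sqrt (by positivity)]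
    field_simp
  set φ : EuclideanSpace ℝ (Fin d) → EuclideanSpace ℝ (Fin d) → ℝ :=
    fun q x => K (h⁻¹ • (q - x)) with hφ
  set m : EuclideanSpace ℝ (Fin d) → ℝ := fun q => ∫ x, φ q x ∂(densityLaw f) with hm
  have hφm : Measurable (Function.uncurry φ) := by
    have h1 : Measurable fun z : EuclideanSpace ℝ (Fin d) × EuclideanSpace ℝ (Fin d) =>
        h⁻¹ • (z.1 - z.2) := by fun_prop
    exact hK.measurable.comp h1
  have hmm : Measurable m := hφm.stronglyMeasurable.integral_prod_right.measurable
  have hφ0 : ∀ q x, 0 ≤ φ q x := fun q x => hK.nonneg _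
  have hφb : ∀ q x, φ q x ≤ b := fun q x => hK.le_apply_zero _
  have hφi : ∀ q, Integrable (φ q) (densityLaw f) := fun q =>
    Integrable.of_bound (hφm.comp measurable_prodMk_left).aestronglyMeasurable b
      (ae_of_all _ fun x => by
        rw [Real.norm_eq_abs, abs_of_nonneg (hφ0 q x)]; exact hφb q x)
  have hm0 : ∀ q, 0 ≤ m q := fun q => integral_nonneg (hφ0 q)
  have hmb : ∀ q, m q ≤ b := fun q => by
    calc m q ≤ ∫ _x, b ∂(densityLaw f) := integral_mono (hφi q) (integrable_const _) (hφb q)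
      _ = b := by simp
  have hmg : ∀ q, m q = h ^ d * smoothedDensity K f h q := fun q =>
    integral_kernel_densityLaw hf hh q
  have hmF : ∀ q, m q ≤ h ^ d * F := fun q => by
    rw [hmg]
    exact mul_le_mul_of_nonneg_left (smoothedDensity_le hK hf hF q) (by positivity)
  set Y : EuclideanSpace ℝ (Fin d) → EuclideanSpace ℝ (Fin d) → ℝ :=
    fun q x => φ q x - m q with hY
  have hYm : Measurable (Function.uncurry Y) := hφm.sub (hmm.comp measurable_fst)
  have hYb : ∀ q x, |Y q x| ≤ b := fun q x =>
    abs_le.2 ⟨by simp only [hY]; linarith [hφ0 q x, hmb q],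
      by simp only [hY]; linarith [hφb q x, hm0 q]⟩
  have hYmean : ∀ q, ∫ x, Y q x ∂(densityLaw f) = 0 := fun q => by
    simp only [hY]
    rw [integral_sub (hφi q) (integrable_const _)]
    simp [hm]
  -- Since `0 ≤ φ ≤ b`, one has `φ ^ 2 ≤ b * φ`, so the variance is at most `b * m q`. Its order `h
  -- ^ d` produces the rate `w`.
  have hYvar : ∀ q, ∫ x, Y q x ^ 2 ∂(densityLaw f) ≤ b * (h ^ d * F) := fun q => by
    have hYq : Measurable (Y q) := hYm.comp measurable_prodMk_left
    calc ∫ x, Y q x ^ 2 ∂(densityLaw f)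
        ≤ ∫ x, ((b - 2 * m q) * φ q x + m q ^ 2) ∂(densityLaw f) := by
          refine integral_mono (Integrable.of_bound (hYq.pow_const 2).aestronglyMeasurable
            (b ^ 2) (ae_of_all _ fun x => ?_))
            (((hφi q).const_mul _).add (integrable_const _)) fun x => ?_
          · rw [Real.norm_eq_abs, abs_pow]
            exact pow_le_pow_left₀ (abs_nonneg _) (hYb q x) 2
          · have := mul_le_mul_of_nonneg_right (hφb q x) (hφ0 q x)
            simp only [hY]
            linarith
      _ = (b - 2 * m q) * m q + m q ^ 2 := by
          rw [integral_add ((hφi q).const_mul _) (integrable_const _), integral_const_mul]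
          simp [hm]
      _ ≤ b * m q := by linarith [sq_nonneg (m q)]
      _ ≤ b * (h ^ d * F) := mul_le_mul_of_nonneg_left (hmF q) hb0
  -- Taking `l = w` in the Chernoff bound, `b * F` cancels the variance term and 4 leaves `-4 * log
  -- n`, as `n * h ^ d * w ^ 2 = log n`. Each index then fails with probability at most `2 / n ^ 4`.
  set t := (b * F + 4) * (n * h ^ d * w) with ht
  have hsub : {ω | ∀ i, |kde K h (fun j => X j ω) (X i ω) - smoothedDensity K f h (X i ω)| ≤
      (b * F + 4 + b) * w}ᶜ ⊆
      ⋃ i, {ω | t ≤ |∑ j ∈ Finset.univ.erase i, Y (X i ω) (X j ω)|} := by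
    intro ω hω
    simp only [Set.mem_compl_iff, Set.mem_ofPred_eq, not_forall, not_le] at hω
    obtain ⟨i, hi⟩ := hω
    refine Set.mem_iUnion.2 ⟨i, ?_⟩
    change t ≤ |∑ j ∈ Finset.univ.erase i, Y (X i ω) (X j ω)|
    by_contra! hlt
    have hsum : kde K h (fun j => X j ω) (X i ω) - smoothedDensity K f h (X i ω) =
        (Y (X i ω) (X i ω) + ∑ j ∈ Finset.univ.erase i, Y (X i ω) (X j ω)) / (n * h ^ d) := by
      rw [Finset.add_sum_erase _ (fun j => Y (X i ω) (X j ω)) (Finset.mem_univ i), kde]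
      simp only [hY, Finset.sum_sub_distrib, Finset.sum_const, Finset.card_univ,
        Fintype.card_fin, nsmul_eq_mul, hmg, hφ]
      field_simp
    rw [hsum, abs_div, abs_of_pos hN, lt_div_iff₀ hN] at hi
    have h1 := abs_add_le (Y (X i ω) (X i ω)) (∑ j ∈ Finset.univ.erase i, Y (X i ω) (X j ω))
    have h2 := hYb (X i ω) (X i ω)
    -- The diagonal term `j = i` is not centred given `X i`; it is bounded by `b`, and this
    -- inequality absorbs it into the summand `b` of the constant `b * F + 4 + b`.
    have h3 : 1 ≤ n * h ^ d * w := by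
      have : (n : ℝ) * h ^ d * w ^ 2 ≤ n * h ^ d * w := by
        refine mul_le_mul_of_nonneg_left ?_ hN.le
        rw [sq]; exact mul_le_of_le_one_left hw0 hw1
      linarith
    have h4 := mul_le_mul_of_nonneg_left h3 hb0
    rw [ht] at hlt
    linarith
  have hexp : -w * t + Fintype.card (Fin n) * (w ^ 2 * (b * (h ^ d * F))) =
      -(4 * Real.log n) := by
    rw [ht, ← hNw, Fintype.card_fin]; ring
  have hbound : ∀ i, μ {ω | t ≤ |∑ j ∈ Finset.univ.erase i, Y (X i ω) (X j ω)|} ≤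
      ENNReal.ofReal (2 / n ^ 4) := fun i => by
    refine (measure_abs_sum_erase_ge_le hX hind hYm hYb hYmean hYvar hw0 hwK i t).trans_eq ?_
    rw [hexp, Real.exp_neg, div_eq_mul_inv, show (4 : ℝ) * Real.log n = (4 : ℕ) * Real.log n by
      norm_num, Real.exp_nat_mul, Real.exp_log hn0]
  calc _ ≤ _ := measure_mono hsub
    _ ≤ ∑ i, μ {ω | t ≤ |∑ j ∈ Finset.univ.erase i, Y (X i ω) (X j ω)|} :=
        measure_iUnion_fintype_le _ _
    _ ≤ ∑ _i : Fin n, ENNReal.ofReal (2 / n ^ 4) := Finset.sum_le_sum fun i _ => hbound i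
    _ = ENNReal.ofReal (n * (2 / n ^ 4)) := by
        rw [Finset.sum_const, Finset.card_univ, Fintype.card_fin, nsmul_eq_mul,
          ENNReal.ofReal_mul hn0.le, ENNReal.ofReal_natCast]
    _ ≤ ENNReal.ofReal (1 / n ^ 2) := by
        refine ENNReal.ofReal_le_ofReal ?_
        rw [← mul_div_assoc, div_le_div_iff₀ (by positivity) (by positivity)]
        have : (0 : ℝ) ≤ n ^ 3 * (n - 2) := mul_nonneg (by positivity) (by linarith)
        linarith
    _ = 1 / (n : ℝ≥0∞) ^ 2 := by
        rw [ENNReal.ofReal_div_of_pos (by positivity), ENNReal.ofReal_one,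
          ENNReal.ofReal_pow hn0.le, ENNReal.ofReal_natCast]

end KDEConcentration

/-! ### Deterministic analysis of Quick Shift paths. -/

section QuickShift

variable {d n : ℕ} {K f : EuclideanSpace ℝ (Fin d) → ℝ} {𝒳 : Set (EuclideanSpace ℝ (Fin d))}

/-- Along a directed path of a Quick Shift graph, the polygonal path through the visited points
stays close to points whose density value is at least the initial one. -/
lemma IsQuickShiftGraph.exists_path {x : Fin n → EuclideanSpace ℝ (Fin d)}
    {ft : EuclideanSpace ℝ (Fin d) → ℝ} {τ : ℝ} {G : Digraph (Fin n)}
    (hG : IsQuickShiftGraph x ft τ G) (hτ : 0 ≤ τ) {i j : Fin n}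
    (hij : Relation.ReflTransGen G.Adj i j) :
    ft (x i) ≤ ft (x j) ∧ ∃ γ : Path (x i) (x j), ∀ y ∈ Set.range γ,
      ∃ l, ft (x i) ≤ ft (x l) ∧ ‖y - x l‖ ≤ τ := by
  obtain ⟨N, xhat, hN, hxhat, hadj⟩ := hG
  induction hij with
  | refl =>
    refine ⟨le_rfl, Path.refl _, ?_⟩
    rintro y ⟨t, rfl⟩
    exact ⟨i, le_rfl, by simpa using hτ⟩
  | @tail b c _ hbc ih =>
    obtain ⟨hib, γ, hγ⟩ := ih
    obtain ⟨rfl, hlt⟩ := (hadj b c).1 hbc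
    refine ⟨hib.trans hlt.le, γ.trans (Path.segment (x b) (x (xhat b))), fun y hy => ?_⟩
    rw [Path.trans_range] at hy
    rcases hy with hy | hy
    · exact hγ y hy
    · rw [Path.range_segment] at hy
      -- The whole edge lies within `τ` of its tail `b`.
      refine ⟨b, hib, (norm_sub_le_of_mem_segment hy).trans (hN b _ (hxhat b).1)⟩

lemma bddAbove_kde_image (hK : IsRadialKernel K) {h : ℝ} (hh : 0 < h)
    (x : Fin n → EuclideanSpace ℝ (Fin d)) : BddAbove (kde K h x '' 𝒳) := by
  refine ⟨1 / (n * h ^ d) * ∑ _i : Fin n, K 0, ?_⟩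
  rintro _ ⟨q, -, rfl⟩
  exact mul_le_mul_of_nonneg_left (Finset.sum_le_sum fun i _ => hK.le_apply_zero _)
    (by positivity)

/-- Separated points cannot be joined in a Quick Shift graph if the density values used are
accurate enough. -/
lemma not_reflTransGen_of_isSeparated (hf : IsDensityOn f 𝒳) (hK : IsRadialKernel K)
    {F α h r A w ε τ δ : ℝ} (hF0 : 0 ≤ F) (hF : ∀ x, f x ≤ F) (hα : 0 ≤ α) (hh : 0 < h)
    (hr : 0 < r) {x : Fin n → EuclideanSpace ℝ (Fin d)} (hx : ∀ i, x i ∈ 𝒳)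
    (hdev : ∀ i, |kde K h x (x i) - smoothedDensity K f h (x i)| ≤ A * w) (hw : 0 ≤ w)
    (hε : 0 < ε) {ft : EuclideanSpace ℝ (Fin d) → ℝ}
    (hft : ∀ q ∈ 𝒳, (1 - ε) * kde K h x q ≤ ft q ∧ ft q ≤ (1 + ε) * kde K h x q)
    (hτ0 : 0 < τ) (hτ : τ < r / 2) {G : Digraph (Fin n)} (hG : IsQuickShiftGraph x ft τ G)
    (hδ1 : 4 * ε * sSup (kde K h x '' 𝒳) < δ) (hA : 0 ≤ A)
    (hδ2 : 4 * (F * ((2 / r) ^ α * ∫ u, K u * ‖u‖ ^ α) + A) * (h ^ α + w) < δ)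
    {i j : Fin n} (hsep : IsSeparated f r δ (x i) (x j)) :
    ¬ Relation.ReflTransGen G.Adj i j := by
  intro hij
  obtain ⟨-, γ, hγ⟩ := hG.exists_path hτ0.le hij
  obtain ⟨S, hS, hlt⟩ := hsep
  obtain ⟨t, ht⟩ := hS γ
  obtain ⟨l, hil, hl⟩ := hγ _ ⟨t, rfl⟩
  set s := γ t
  set M := sSup (f '' (S + Metric.ball 0 r)) with hMdef
  set m := sInf (f '' (Metric.ball (x i) r ∪ Metric.ball (x j) r)) with hmdef
  have hbdd : BddAbove (f '' (S + Metric.ball 0 r)) :=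
    ⟨F, by rintro _ ⟨y, -, rfl⟩; exact hF y⟩
  -- Since `x l` is within `r / 2` of `s ∈ S`, this half-radius ball lies in `S + Metric.ball 0 r`.
  have hM : ∀ y ∈ Metric.ball (x l) (r / 2), f y ≤ M := fun y hy => by
    refine le_csSup hbdd ⟨y, Set.mem_add.2 ⟨s, ht, y - s, ?_, by abel⟩, rfl⟩
    rw [mem_ball_zero_iff]
    rw [Metric.mem_ball, dist_eq_norm] at hy
    have := norm_sub_le_norm_sub_add_norm_sub y (x l) s
    rw [norm_sub_rev (x l) s] at this
    linarith
  have hM0 : 0 ≤ M := (hf.nonneg _).trans (hM _ (Metric.mem_ball_self (by linarith)))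
  have hm : ∀ y ∈ Metric.ball (x i) (r / 2), m ≤ f y := fun y hy =>
    csInf_le ⟨0, by rintro _ ⟨z, -, rfl⟩; exact hf.nonneg z⟩
      ⟨y, Or.inl (Metric.ball_subset_ball (by linarith) hy), rfl⟩
  set J := ∫ u, K u * ‖u‖ ^ α with hJ
  have hJ0 : 0 ≤ J := integral_nonneg fun u => mul_nonneg (hK.nonneg u) (by positivity)
  have h1 := smoothedDensity_le_of_ball hK hf hF0 hF hα hh (half_pos hr) hM0 hM
  have h2 := le_smoothedDensity_of_ball hK hf hF0 hF hα hh (half_pos hr) hm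
  have hT : F * ((h / (r / 2)) ^ α * J) = F * ((2 / r) ^ α * J) * h ^ α := by
    rw [show h / (r / 2) = 2 / r * h by field_simp, Real.mul_rpow (by positivity) hh.le]
    ring
  rw [hT] at h1 h2
  set D := F * ((2 / r) ^ α * J) with hD
  have hD0 : 0 ≤ D := by positivity
  have h3 := (abs_le.1 (hdev i)).1
  have h4 := (abs_le.1 (hdev l)).2
  have h5 : (1 - ε) * kde K h x (x i) ≤ (1 + ε) * kde K h x (x l) :=
    ((hft _ (hx i)).1.trans hil).trans (hft _ (hx l)).2
  have hsup : ∀ a, ε * kde K h x (x a) ≤ ε * sSup (kde K h x '' 𝒳) := fun a =>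
    mul_le_mul_of_nonneg_left (le_csSup (bddAbove_kde_image hK hh x) ⟨_, hx a, rfl⟩) hε.le
  have h6 := hsup i
  have h7 := hsup l
  have h8 : 0 ≤ D * w := mul_nonneg hD0 hw
  have h9 : 0 ≤ A * h ^ α := mul_nonneg hA (by positivity)
  -- Altogether `m - M ≤ 2 * D * h ^ α + 2 * A * w + 2 * ε * sup`. The factors 4 in the two
  -- conditions on `δ` make the oracle error and the rest each less than `δ / 2`.
  linarith

end QuickShift

/-! ### Choice of constants and the good event. -/

theorem mainTheorem2 {d : ℕ} (hd : 0 < d)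
    (𝒳 : Set (EuclideanSpace ℝ (Fin d))) (f : EuclideanSpace ℝ (Fin d) → ℝ)
    (hf : IsDensityOn f 𝒳)
    (α Cα : ℝ) (hα : IsHolderDensity f 𝒳 α Cα)
    (K : EuclideanSpace ℝ (Fin d) → ℝ) (hK : IsRadialKernel K) :
    ∃ C : ℝ, 0 < C ∧ ∀ r : ℝ, 0 < r → ∃ C' : ℝ, 0 < C' ∧
      ∀ h : ℕ → ℝ, (∀ n, 0 < h n) → Tendsto h atTop (𝓝 0) →
        Tendsto (fun n : ℕ => Real.log n / (n * h n ^ d)) atTop (𝓝 0) →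
        ∀ᶠ n : ℕ in atTop,
          ∀ (Ω : Type*) [MeasurableSpace Ω] (μ : Measure Ω) [IsProbabilityMeasure μ]
            (X : Fin n → Ω → EuclideanSpace ℝ (Fin d)),
            (∀ i, HasLaw (X i) (densityLaw f) μ) → iIndepFun X μ →
            ∀ (ε : ℝ) (p : ℝ≥0∞) (ft : Ω → EuclideanSpace ℝ (Fin d) → ℝ),
              0 < ε → IsKDEOracle μ 𝒳 K (h n) ε p X ft →
              ∀ τ : ℝ, 0 < τ → τ < r / 2 →
                μ {ω | ∀ G : Digraph (Fin n), IsQuickShiftGraph (fun i => X i ω) (ft ω) τ G →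
                    ∀ δ : ℝ, 0 < δ →
                      C * ε * sSup (kde K (h n) (fun i => X i ω) '' 𝒳) < δ →
                      C' * (h n ^ α + √(Real.log n / (n * h n ^ d))) < δ →
                      ∀ i j, IsSeparated f r δ (X i ω) (X j ω) →
                        ¬ Relation.ReflTransGen G.Adj i j}ᶜ ≤ p + 1 / (n : ℝ≥0∞) ^ 2 := by
  obtain ⟨F, hF0, hF⟩ := hf.exists_bound hα
  have hα0 := hα.1
  have hK0 : 0 ≤ K 0 := hK.nonneg 0
  set A := K 0 * F + 4 + K 0 with hAdef
  have hA : 0 < A := by positivity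
  refine ⟨4, by norm_num, fun r hr =>
    ⟨4 * (F * ((2 / r) ^ α * ∫ u, K u * ‖u‖ ^ α) + A), ?_, fun h hh _ hlim => ?_⟩⟩
  · have hJ0 : 0 ≤ ∫ u, K u * ‖u‖ ^ α :=
      integral_nonneg fun u => mul_nonneg (hK.nonneg u) (by positivity)
    positivity
  have hsqrt : Tendsto (fun n : ℕ => √(Real.log n / (n * h n ^ d))) atTop (𝓝 0) := by
    simpa using hlim.sqrt
  have hsqrtK : Tendsto (fun n : ℕ => √(Real.log n / (n * h n ^ d)) * K 0) atTop (𝓝 0) := by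
    simpa using hsqrt.mul_const (K 0)
  filter_upwards [eventually_ge_atTop 3, hlim.eventually (ge_mem_nhds one_pos),
    hsqrt.eventually (ge_mem_nhds one_pos), hsqrtK.eventually (ge_mem_nhds one_pos)]
    with n hn hn1 hw1 hwK Ω _ μ _ X hX hind ε p ft hε horacle τ hτ0 hτ
  have hhn := hh n
  have hn0 : (0 : ℝ) < n := by
    have : 0 < n := by omega
    exact_mod_cast this
  -- The oracle's bandwidth requirement is `log n / (n h ^ d) ≤ 1` after taking `d`-th roots.
  have hbw : (Real.log n / n) ^ (1 / (d : ℝ)) ≤ h n := by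
    rw [div_le_one (by positivity)] at hn1
    have h0 : 0 ≤ Real.log n / n := div_nonneg (Real.log_natCast_nonneg n) hn0.le
    calc (Real.log n / n) ^ (1 / (d : ℝ)) ≤ (h n ^ d) ^ (1 / (d : ℝ)) := by
          refine Real.rpow_le_rpow h0 ?_ (by positivity)
          rw [div_le_iff₀ hn0]
          linarith
      _ = h n := by rw [one_div, Real.pow_rpow_inv_natCast hhn.le hd.ne']
  have hor := horacle hbw
  have hdev := measure_kde_deviation_le hf hK hF hX hind hn hhn rfl hw1 hwK
  have hmem : μ {ω | ∀ i, X i ω ∈ 𝒳}ᶜ = 0 := by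
    refine ae_iff.1 (ae_all_iff.2 fun i => ?_)
    have hmap : (μ.map (X i)) 𝒳ᶜ = 0 := by rw [(hX i).map_eq, densityLaw_compl_eq_zero hf]
    rwa [Measure.map_apply_of_aemeasurable (hX i).aemeasurable
      hf.isCompact.measurableSet.compl] at hmap
  set E₁ := {ω | ∀ q ∈ 𝒳, (1 - ε) * kde K (h n) (fun i => X i ω) q ≤ ft ω q ∧
    ft ω q ≤ (1 + ε) * kde K (h n) (fun i => X i ω) q} with hE₁
  set E₂ := {ω | ∀ i, |kde K (h n) (fun j => X j ω) (X i ω) -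
    smoothedDensity K f (h n) (X i ω)| ≤ A * √(Real.log n / (n * h n ^ d))} with hE₂
  set E₃ := {ω | ∀ i, X i ω ∈ 𝒳} with hE₃
  calc _ ≤ μ (E₁ᶜ ∪ E₂ᶜ ∪ E₃ᶜ) := by
        -- `ft` is arbitrary, so these events need not be measurable; monotonicity and subadditivity
        -- of the outer measure suffice.
        refine measure_mono ?_
        rw [← Set.compl_inter, ← Set.compl_inter, Set.compl_subset_compl]
        rintro ω ⟨⟨h₁, h₂⟩, h₃⟩ G hG δ _ hδ1 hδ2 i j hsep
        exact not_reflTransGen_of_isSeparated hf hK hF0.le hF hα0.le hhn hr h₃ h₂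
          (Real.sqrt_nonneg _) hε h₁ hτ0 hτ hG hδ1 hA.le hδ2 hsep
    _ ≤ μ E₁ᶜ + μ E₂ᶜ + μ E₃ᶜ :=
        (measure_union_le _ _).trans (by gcongr; exact measure_union_le _ _)
    _ ≤ p + 1 / (n : ℝ≥0∞) ^ 2 := by
        rw [hmem, add_zero]
        exact add_le_add hor hdev
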